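/- For $\ell\in\{5,10\}$ and $\operatorname{Re}(s)>1$ put $$P_\ell(s)=\prod_{p\equiv 1\ (\mathrm{mod}\ \ell)}\Bigl(1-\frac1{p^{s}}\Bigr)^{-4},$$ the product being over primes $p$ (note $\varphi(5)=\varphi(10)=4$). This product converges for every $s$ with $\operatorname{Re}(s)>1$, the function $P_\ell$ extends meromorphically to a neighbourhood of $s=1$ with a simple pole there, and its residue $$\rho(1,\ell)=\lim_{\substack{s\to1\\ \operatorname{Re}(s)>1}}(s-1)P_\ell(s)$$ is, for both $\ell=5$ and $\ell=10$, $$\rho(1,\ell)=\frac{5\ln(2+\sqrt5)}{3\pi^2}\prod_{p\equiv1\ (\mathrm{mod}\ \ell)}\Bigl(1-\frac1{p^2}\Bigr)^{-2},$$ where the product on the right converges. Moreover, let $\chi$ be the (unique) Dirichlet character modulo $\ell$ with $\chi(2)=i$ if $\ell=5$, respectively $\chi(3)=i$ if $\ell=10$, and let $L_1,L_2,L_3,L_4$ be the Dirichlet $L$-functions of the characters $1,\chi,\chi^2,\chi^3$ modulo $\ell$ (continued analytically where necessary; $1$ denotes the principal character). Then for $\operatorname{Re}(s)>1$ $$\frac{L_1(s)L_2(s)L_3(s)L_4(s)}{L_1(2s)L_3(2s)}=\prod_{p\equiv1\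 (\mathrm{mod}\ \ell)}\Bigl(\frac{1+p^{-s}}{1-p^{-s}}\Bigr)^{2},$$ and, with principal fourth roots, the following hold. For $\ell=5$: $$L_2(1)=2^{1/2}5^{-5/4}(3+4i)^{1/4}\pi,\quad L_3(1)=\frac{2\ln(2+\sqrt5)}{3\sqrt5},\quad L_4(1)=2^{1/2}5^{-5/4}(3-4i)^{1/4}\pi,\quad L_3(2)=\frac{4\pi^2\sqrt5}{125}.$$ For $\ell=10$: $$L_2(1)=2^{-1/2}5^{-3/4}(3+4i)^{1/4}\pi,\quad L_3(1)=\frac{\ln(2+\sqrt5)}{\sqrt5},\quad L_4(1)=2^{-1/2}5^{-3/4}(3-4i)^{1/4}\pi,\quad L_3(2)=\frac{\pi^2\sqrt5}{25}.$$ -/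

import Mathlib

open Filter Topology

/-- The primes in the residue class of `k` modulo `ℓ`. -/
abbrev PrimesMod (k ℓ : ℕ) : Type := {p : ℕ // p.Prime ∧ p ≡ k [MOD ℓ]}

/-- The Euler factor `(1 - p^(-s))^(-φ(ℓ))`, where `φ` is Euler's totient. -/
noncomputable def progressionFactor (ℓ : ℕ) (s : ℂ) (p : ℕ) : ℂ :=
  (1 - 1 / (p : ℂ) ^ s) ^ (-(Nat.totient ℓ : ℤ))

/-- The product of `(1 - p^(-s))^(-φ(ℓ))` over all primes `p ≡ k (mod ℓ)`. -/
noncomputable def progressionProduct (k ℓ : ℕ) (s : ℂ) : ℂ :=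
  ∏' p : PrimesMod k ℓ, progressionFactor ℓ s p

/-- `ρ(k, ℓ) = r`, that is, `(s - 1) ∏_{p ≡ k (mod ℓ)} (1 - p^(-s))^(-φ(ℓ))` tends to `r` as
`s → 1` inside the half-plane `Re s > 1` where the product converges. -/
def IsRho (k ℓ : ℕ) (r : ℂ) : Prop :=
  Tendsto (fun s : ℂ => (s - 1) * progressionProduct k ℓ s) (𝓝[{s : ℂ | 1 < s.re}] 1) (𝓝 r)

/-- The function `s ↦ ∏_{p ≡ k (mod ℓ)} (1 - p^(-s))^(-φ(ℓ))`, `Re s > 1`, continues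
meromorphically to a neighbourhood of `1`, with at most a simple pole at `1`, and the residue
there is `r`: some `F` analytic at `1` agrees near `1` with `(s - 1)` times the product wherever
`Re s > 1`, and `F 1 = r`. -/
def HasResidueAtOne (k ℓ : ℕ) (r : ℂ) : Prop :=
  ∃ F : ℂ → ℂ, AnalyticAt ℂ F 1 ∧
    (∀ᶠ s in 𝓝 (1 : ℂ), 1 < s.re → F s = (s - 1) * progressionProduct k ℓ s) ∧ F 1 = r

/-- `(5 ln(2 + √5) / (3 π²)) ∏_{p ≡ 1 (mod ℓ)} (1 - p^(-2))^(-2)`. -/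
noncomputable def rhoValue (ℓ : ℕ) : ℝ :=
  5 * Real.log (2 + √5) / (3 * Real.pi ^ 2) *
    ∏' p : PrimesMod 1 ℓ, (1 - 1 / (p : ℝ) ^ 2) ^ (-2 : ℤ)

/-- `L₁(s) L₂(s) L₃(s) L₄(s) / (L₁(2s) L₃(2s))`, where `L_j` is the Dirichlet `L`-function of
`χ ^ (j - 1)`, a character modulo `ℓ`. -/
noncomputable def quarticQuotient {ℓ : ℕ} [NeZero ℓ] (χ : DirichletCharacter ℂ ℓ) (s : ℂ) : ℂ :=
  ((1 : DirichletCharacter ℂ ℓ).LFunction s * χ.LFunction s * (χ ^ 2).LFunction s *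
      (χ ^ 3).LFunction s) /
    ((1 : DirichletCharacter ℂ ℓ).LFunction (2 * s) * (χ ^ 2).LFunction (2 * s))

/-!
The Euler factors of `L₁ L₂ L₃ L₄` at a prime `p` with `χ(p) = c` multiply to
`∏ⱼ (1 - cʲ p^(-s))⁻¹`. Dividing by the factors of `L₁(2s) L₃(2s)` cancels everything at the primes
with `c ≠ 1` and leaves `((1 + p^(-s)) / (1 - p^(-s)))²` at the primes `p ≡ 1`
(`IsFaithfulQuartic.hasProd_quarticQuotient`). As
`(1 - x)⁻⁴ = ((1 + x) / (1 - x))² (1 - x²)⁻²`, the product `P_ℓ(s)` is this quotient times the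
square of `∏ (1 - p^(-2s))⁻¹ = partialZeta 1 ℓ (2s)`, which is analytic for `Re s > 1/2`. The only
pole at `s = 1` is the one of `L₁`, so the residue is a product of values of `L`-functions
(`IsFaithfulQuartic.hasResidueAtOne`).

The values at `1` come from `ZMod.LFunction_one_eq_integral`: for periodic coefficients `Φ` with
sum zero over a period, `L(Φ, 1)` is the integral over `[0, 1]` of the generating function of `Φ`.
Modulo `5` the generating functions are rational with denominator `1 + x + x² + x³ + x⁴`, which
splits over `ℚ(√5)` into the quadratics `x² + 2 x cos (π/5) + 1` and `x² + 2 x cos (3π/5) + 1`: the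
odd characters give arctangents and the even one gives a logarithm. The value `L₃(2)` follows from
the Fourier expansion of `χ²` and of the second Bernoulli polynomial. The characters modulo `10` are
induced from those modulo `5`, so their `L`-functions differ only by the Euler factor at `2`.
-/

/-! ### Euler products over a residue class -/

/-- `exp (∑ -log (1 - p^(-w)))`, the sum over the primes `p ≡ k (mod ℓ)`: an Euler product
written as an exponential, so that its analyticity follows from that of a series. -/
noncomputable def partialZeta (k ℓ : ℕ) (w : ℂ) : ℂ :=
  Complex.exp (∑' p : PrimesMod k ℓ, -Complex.log (1 + -((p : ℕ) : ℂ) ^ (-w)))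

lemma norm_prime_cpow_neg {p : ℕ} (hp : p.Prime) (w : ℂ) :
    ‖(p : ℂ) ^ (-w)‖ = (p : ℝ) ^ (-w.re) := by
  rw [Complex.norm_natCast_cpow_of_pos hp.pos, Complex.neg_re]

lemma norm_prime_cpow_neg_le_half {p : ℕ} (hp : p.Prime) {w : ℂ} (hw : 1 < w.re) :
    ‖(p : ℂ) ^ (-w)‖ ≤ 1 / 2 := by
  rw [norm_prime_cpow_neg hp]
  have hp2 : (2 : ℝ) ≤ p := by exact_mod_cast hp.two_le
  calc (p : ℝ) ^ (-w.re) ≤ (p : ℝ) ^ (-1 : ℝ) :=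
        Real.rpow_le_rpow_of_exponent_le (by linarith) (by linarith)
    _ = 1 / p := by rw [Real.rpow_neg_one, one_div]
    _ ≤ 1 / 2 := one_div_le_one_div_of_le (by norm_num) hp2

lemma summable_primesMod_rpow (k ℓ : ℕ) {σ : ℝ} (hσ : 1 < σ) :
    Summable fun p : PrimesMod k ℓ => ((p : ℕ) : ℝ) ^ (-σ) :=
  (Real.summable_nat_rpow.mpr (by linarith : -σ < -1)).comp_injective Subtype.val_injective

lemma norm_log_one_sub_prime_cpow_le {p : ℕ} (hp : p.Prime) {w : ℂ} {σ : ℝ} (hσ : 1 < σ)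
    (hw : σ < w.re) :
    ‖-Complex.log (1 + -(p : ℂ) ^ (-w))‖ ≤ 3 / 2 * (p : ℝ) ^ (-σ) := by
  have hp1 : (1 : ℝ) ≤ p := by exact_mod_cast hp.one_le
  have h := Complex.norm_log_one_add_half_le_self (z := -(p : ℂ) ^ (-w))
    (by rw [norm_neg]; exact norm_prime_cpow_neg_le_half hp (hσ.trans hw))
  rw [norm_neg, norm_prime_cpow_neg hp] at h
  rw [norm_neg]
  refine h.trans ?_
  gcongr

lemma one_add_prime_cpow_ne_zero {p : ℕ} (hp : p.Prime) {w : ℂ} (hw : 1 < w.re) :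
    1 + (p : ℂ) ^ (-w) ≠ 0 := by
  intro h
  have h1 : (p : ℂ) ^ (-w) = -1 := by linear_combination h
  have h2 := norm_prime_cpow_neg_le_half hp hw
  rw [h1] at h2
  norm_num at h2

lemma one_sub_prime_cpow_ne_zero {p : ℕ} (hp : p.Prime) {w : ℂ} (hw : 1 < w.re) :
    1 - (p : ℂ) ^ (-w) ≠ 0 := by
  intro h
  have h1 : (p : ℂ) ^ (-w) = 1 := by linear_combination -h
  have h2 := norm_prime_cpow_neg_le_half hp hw
  rw [h1] at h2
  norm_num at h2

lemma hasProd_partialZeta (k ℓ : ℕ) {w : ℂ} (hw : 1 < w.re) :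
    HasProd (fun p : PrimesMod k ℓ => (1 - ((p : ℕ) : ℂ) ^ (-w))⁻¹) (partialZeta k ℓ w) := by
  obtain ⟨σ, hσ, hσw⟩ := exists_between hw
  have hs : Summable fun p : PrimesMod k ℓ => -Complex.log (1 + -((p : ℕ) : ℂ) ^ (-w)) :=
    .of_norm_bounded ((summable_primesMod_rpow k ℓ hσ).mul_left (3 / 2))
      fun p => norm_log_one_sub_prime_cpow_le p.2.1 hσ hσw
  refine hs.hasSum.cexp.congr_fun fun p => ?_
  rw [Function.comp_apply, Complex.exp_neg, ← sub_eq_add_neg,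
    Complex.exp_log (one_sub_prime_cpow_ne_zero p.2.1 hw)]

lemma analyticAt_partialZeta (k ℓ : ℕ) {w : ℂ} (hw : 1 < w.re) :
    AnalyticAt ℂ (partialZeta k ℓ) w := by
  obtain ⟨σ, hσ, hσw⟩ := exists_between hw
  have hopen : IsOpen {z : ℂ | σ < z.re} := isOpen_lt continuous_const Complex.continuous_re
  -- On `Re z > σ > 1` the series is dominated by `∑ (3/2) p^(-σ)`.
  have hd : DifferentiableOn ℂ
      (fun z => ∑' p : PrimesMod k ℓ, -Complex.log (1 + -((p : ℕ) : ℂ) ^ (-z)))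
      {z : ℂ | σ < z.re} := by
    refine Complex.differentiableOn_tsum_of_summable_norm
      ((summable_primesMod_rpow k ℓ hσ).mul_left (3 / 2)) (fun p z hz => ?_) hopen
      fun p z hz => norm_log_one_sub_prime_cpow_le p.2.1 hσ hz
    have hp0 : ((p : ℕ) : ℂ) ≠ 0 := by exact_mod_cast p.2.1.ne_zero
    have hmem : 1 + -((p : ℕ) : ℂ) ^ (-z) ∈ Complex.slitPlane := by
      refine Complex.mem_slitPlane_of_norm_lt_one ?_
      rw [norm_neg]
      exact (norm_prime_cpow_neg_le_half p.2.1 (hσ.trans hz)).trans_lt (by norm_num)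
    refine DifferentiableAt.differentiableWithinAt ?_
    have hd : DifferentiableAt ℂ (fun z : ℂ => 1 + -((p : ℕ) : ℂ) ^ (-z)) z :=
      (((differentiableAt_id.neg).const_cpow (Or.inl hp0)).neg).const_add 1
    exact (hd.clog hmem).neg
  exact (hd.cexp).analyticAt (hopen.mem_nhds hσw)

/-- Factors equal to `1` outside a residue class may be dropped from a product over all primes. -/
lemma hasProd_primesMod_of_hasProd_primes {k ℓ : ℕ} {f : Nat.Primes → ℂ} {g : ℕ → ℂ} {a : ℂ}
    (hf : HasProd f a) (hg : ∀ p : Nat.Primes, (p : ℕ) ≡ k [MOD ℓ] → f p = g p)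
    (h1 : ∀ p : Nat.Primes, ¬ (p : ℕ) ≡ k [MOD ℓ] → f p = 1) :
    HasProd (fun p : PrimesMod k ℓ => g p) a := by
  let ι : PrimesMod k ℓ → Nat.Primes := fun p => ⟨p, p.2.1⟩
  have hι : Function.Injective ι := fun p q h =>
    Subtype.ext (congrArg (fun r : Nat.Primes => (r : ℕ)) h)
  refine ((hι.hasProd_iff fun p hp => h1 p fun h => hp ⟨⟨p, p.2, h⟩, rfl⟩).mpr hf).congr_fun
    fun p => ?_
  exact (hg (ι p) p.2.2).symm

/-! ### Quartic characters -/

/-- A character modulo `ℓ` of order dividing `4` that takes the value `1` at a prime `p` only when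
`p ≡ 1 (mod ℓ)`. -/
structure IsFaithfulQuartic {ℓ : ℕ} (χ : DirichletCharacter ℂ ℓ) : Prop where
  pow_four : χ ^ 4 = 1
  sq_ne_one : χ ^ 2 ≠ 1
  apply_of_modEq : ∀ p : ℕ, p ≡ 1 [MOD ℓ] → χ p = 1
  apply_of_not_modEq : ∀ p : ℕ, ¬ p ≡ 1 [MOD ℓ] →
    χ p = 0 ∨ χ p = -1 ∨ χ p = Complex.I ∨ χ p = -Complex.I

namespace IsFaithfulQuartic

variable {ℓ : ℕ} {χ : DirichletCharacter ℂ ℓ}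

lemma ne_one (hχ : IsFaithfulQuartic χ) : χ ≠ 1 := fun h => hχ.sq_ne_one (by rw [h, one_pow])

lemma cube_ne_one (hχ : IsFaithfulQuartic χ) : χ ^ 3 ≠ 1 := by
  intro h
  have h4 := hχ.pow_four
  rw [pow_succ, h, one_mul] at h4
  exact hχ.ne_one h4

variable [NeZero ℓ]

/-- At each prime the six Euler factors of the quotient cancel unless `χ(p) = 1`, because
`∏ⱼ (1 - cʲ x) = 1 - x⁴ = (1 - x²)(1 + x²)` for `c = ±i` and `((1 - x)(1 + x))² = (1 - x²)²` for
`c = -1`. -/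
lemma hasProd_quarticQuotient (hχ : IsFaithfulQuartic χ) {s : ℂ} (hs : 1 < s.re) :
    HasProd (fun p : PrimesMod 1 ℓ =>
      ((1 + 1 / ((p : ℕ) : ℂ) ^ s) / (1 - 1 / ((p : ℕ) : ℂ) ^ s)) ^ 2) (quarticQuotient χ s) := by
  have h2s : 1 < (2 * s).re := by
    simp only [Complex.mul_re, Complex.re_ofNat, Complex.im_ofNat, zero_mul, sub_zero]
    linarith
  have h2s1 : 2 * s ≠ 1 := by
    intro h; rw [h] at h2s; simp at h2s
  have euler (ψ : DirichletCharacter ℂ ℓ) {z : ℂ} (hz : 1 < z.re) :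
      HasProd (fun p : Nat.Primes => (1 - ψ p * (p : ℂ) ^ (-z))⁻¹) (ψ.LFunction z) := by
    rw [ψ.LFunction_eq_LSeries hz]
    exact ψ.LSeries_eulerProduct_hasProd hz
  have hprod := ((((euler 1 hs).mul (euler χ hs)).mul (euler (χ ^ 2) hs)).mul
    (euler (χ ^ 3) hs)).div₀ ((euler 1 h2s).mul (euler (χ ^ 2) h2s))
    (mul_ne_zero (DirichletCharacter.LFunction_ne_zero_of_one_le_re _ (.inr h2s1) h2s.le)
      (DirichletCharacter.LFunction_ne_zero_of_one_le_re _ (.inr h2s1) h2s.le))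
  have hsq (p : Nat.Primes) : (p : ℂ) ^ (-(2 * s)) = ((p : ℂ) ^ (-s)) ^ 2 := by
    rw [← Complex.cpow_nat_mul]; congr 1; push_cast; ring
  have hdiv (p : ℕ) : 1 / (p : ℂ) ^ s = (p : ℂ) ^ (-s) := by rw [Complex.cpow_neg, one_div]
  simp only [← hχ.pow_four, MulChar.pow_apply' _ (by decide : (4 : ℕ) ≠ 0),
    MulChar.pow_apply' _ (by decide : (3 : ℕ) ≠ 0),
    MulChar.pow_apply' _ (by decide : (2 : ℕ) ≠ 0)] at hprod
  -- `hprod` has the principal character as `χ ^ 4` in its factors and as `1` in its value.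
  rw [hχ.pow_four] at hprod
  refine hasProd_primesMod_of_hasProd_primes (g := fun p : ℕ =>
    ((1 + 1 / (p : ℂ) ^ s) / (1 - 1 / (p : ℂ) ^ s)) ^ 2) hprod (fun p hp => ?_) fun p hp => ?_
  · simp only [hχ.apply_of_modEq p hp, hsq, hdiv]
    have h1 := one_sub_prime_cpow_ne_zero p.2 hs
    have h2 := one_add_prime_cpow_ne_zero p.2 hs
    have h3 : 1 - ((p : ℂ) ^ (-s)) ^ 2 ≠ 0 := by
      rw [show 1 - ((p : ℂ) ^ (-s)) ^ 2 = (1 - (p : ℂ) ^ (-s)) * (1 + (p : ℂ) ^ (-s)) by ring]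
      exact mul_ne_zero h1 h2
    simp only [one_pow, one_mul]
    field_simp
    ring
  · have h1 := one_sub_prime_cpow_ne_zero p.2 hs
    have h2 := one_add_prime_cpow_ne_zero p.2 hs
    have h3 := one_sub_prime_cpow_ne_zero p.2 h2s
    have h4 := one_add_prime_cpow_ne_zero p.2 h2s
    rw [hsq] at h3 h4
    simp only [hsq]
    generalize (p : ℂ) ^ (-s) = x at *
    have hI (c : ℂ) (hc2 : c ^ 2 = -1) : (1 - c ^ 4 * x)⁻¹ * (1 - c * x)⁻¹ * (1 - c ^ 2 * x)⁻¹ *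
        (1 - c ^ 3 * x)⁻¹ / ((1 - c ^ 4 * x ^ 2)⁻¹ * (1 - c ^ 2 * x ^ 2)⁻¹) = 1 := by
      have hc4 : c ^ 4 = 1 := by rw [show c ^ 4 = (c ^ 2) ^ 2 by ring, hc2]; norm_num
      have hc3 : c ^ 3 = -c := by rw [pow_succ, hc2]; ring
      have hprod : (1 - c * x) * (1 + c * x) = 1 + x ^ 2 := by linear_combination -x ^ 2 * hc2
      have hne := hprod ▸ h4
      have h5 := left_ne_zero_of_mul hne
      have h6 := right_ne_zero_of_mul hne
      rw [hc4, hc3, hc2]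
      simp only [one_mul, neg_mul, sub_neg_eq_add]
      rw [← hprod, show 1 - x ^ 2 = (1 - x) * (1 + x) by ring]
      field_simp
      rw [mul_comm x c]
      exact div_self hne
    rcases hχ.apply_of_not_modEq p hp with h | h | h | h <;> rw [h]
    · simp
    · norm_num
      field_simp
      ring
    · exact hI _ Complex.I_sq
    · exact hI _ (by rw [neg_sq, Complex.I_sq])

/-- The Euler factor splits as `(1 - x)⁻⁴ = ((1 + x) / (1 - x))² (1 - x²)⁻²`. -/
lemma hasProd_progressionFactor (hχ : IsFaithfulQuartic χ) (hℓ : ℓ.totient = 4) {s : ℂ}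
    (hs : 1 < s.re) :
    HasProd (fun p : PrimesMod 1 ℓ => progressionFactor ℓ s p)
      (quarticQuotient χ s * partialZeta 1 ℓ (2 * s) ^ 2) := by
  have h2s : 1 < (2 * s).re := by
    simp only [Complex.mul_re, Complex.re_ofNat, Complex.im_ofNat, zero_mul, sub_zero]
    linarith
  refine ((hχ.hasProd_quarticQuotient hs).mul ((hasProd_partialZeta 1 ℓ h2s).pow 2)).congr_fun
    fun p => ?_
  have hsq : ((p : ℕ) : ℂ) ^ (-(2 * s)) = (((p : ℕ) : ℂ) ^ (-s)) ^ 2 := by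
    rw [← Complex.cpow_nat_mul]; congr 1; push_cast; ring
  have h1 := one_sub_prime_cpow_ne_zero p.2.1 hs
  have h2 := one_add_prime_cpow_ne_zero p.2.1 hs
  have h3 := one_sub_prime_cpow_ne_zero p.2.1 h2s
  rw [progressionFactor, hℓ, one_div, ← Complex.cpow_neg, hsq]
  rw [hsq] at h3
  generalize ((p : ℕ) : ℂ) ^ (-s) = x at *
  rw [zpow_neg, Nat.cast_ofNat, zpow_ofNat]
  field_simp
  ring

/-- The residue of the product at `1` in terms of the values of the `L`-functions. -/
lemma hasResidueAtOne (hχ : IsFaithfulQuartic χ) (hℓ : ℓ.totient = 4) :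
    HasResidueAtOne 1 ℓ
      ((∏ p ∈ ℓ.primeFactors, (1 - (p : ℂ)⁻¹)) * χ.LFunction 1 * (χ ^ 2).LFunction 1 *
        (χ ^ 3).LFunction 1 /
        ((1 : DirichletCharacter ℂ ℓ).LFunction 2 * (χ ^ 2).LFunction 2) *
        partialZeta 1 ℓ 2 ^ 2) := by
  have han {ψ : DirichletCharacter ℂ ℓ} (hψ : ψ ≠ 1) (z : ℂ) : AnalyticAt ℂ ψ.LFunction z :=
    (DirichletCharacter.differentiable_LFunction hψ).analyticAt z
  have hT : AnalyticAt ℂ (DirichletCharacter.LFunction (1 : DirichletCharacter ℂ ℓ)) (2 * 1) := by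
    refine DifferentiableOn.analyticAt (s := {1}ᶜ) (fun z hz => ?_)
      (isOpen_compl_singleton.mem_nhds (by norm_num))
    exact (DirichletCharacter.differentiableAt_LFunction _ _ (.inl hz)).differentiableWithinAt
  have hm : AnalyticAt ℂ (fun s : ℂ => 2 * s) 1 := analyticAt_const.mul analyticAt_id
  refine ⟨fun s => DirichletCharacter.LFunctionTrivChar₁ ℓ s * χ.LFunction s *
      (χ ^ 2).LFunction s * (χ ^ 3).LFunction s /
      ((1 : DirichletCharacter ℂ ℓ).LFunction (2 * s) * (χ ^ 2).LFunction (2 * s)) *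
      partialZeta 1 ℓ (2 * s) ^ 2, ?_, ?_, ?_⟩
  · refine (((((DirichletCharacter.differentiable_LFunctionTrivChar₁ ℓ).analyticAt 1).mul
      (han hχ.ne_one 1)).mul (han hχ.sq_ne_one 1)).mul (han hχ.cube_ne_one 1)).div
      ((hT.comp hm).mul ((han hχ.sq_ne_one (2 * 1)).comp hm)) ?_ |>.mul
      (((analyticAt_partialZeta 1 ℓ (by norm_num : 1 < (2 * 1 : ℂ).re)).comp hm).pow 2)
    exact mul_ne_zero
      (DirichletCharacter.LFunction_ne_zero_of_one_le_re _ (.inr (by norm_num)) (by norm_num))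
      (DirichletCharacter.LFunction_ne_zero_of_one_le_re _ (.inr (by norm_num)) (by norm_num))
  · refine Eventually.of_forall fun s hs => ?_
    have hs1 : s ≠ 1 := by rintro rfl; simp at hs
    rw [progressionProduct, (hχ.hasProd_progressionFactor hℓ hs).tprod_eq, quarticQuotient]
    simp only [DirichletCharacter.LFunctionTrivChar₁, Function.update_of_ne hs1,
      DirichletCharacter.LFunctionTrivChar]
    ring
  · simp only [DirichletCharacter.LFunctionTrivChar₁, Function.update_self, mul_one]

end IsFaithfulQuartic

lemma HasResidueAtOne.isRho {k ℓ : ℕ} {r : ℂ} (h : HasResidueAtOne k ℓ r) : IsRho k ℓ r := by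
  obtain ⟨F, hF, hev, rfl⟩ := h
  refine (hF.continuousAt.tendsto.mono_left nhdsWithin_le_nhds).congr' ?_
  filter_upwards [hev.filter_mono nhdsWithin_le_nhds, self_mem_nhdsWithin] with s h1 h2
  exact h1 h2

/-- The real product in `rhoValue`, read off from the complex one by taking real parts. -/
lemma hasProd_real_partialZeta_two_sq (k ℓ : ℕ) :
    HasProd (fun p : PrimesMod k ℓ => (1 - 1 / ((p : ℕ) : ℝ) ^ 2) ^ (-2 : ℤ))
      (partialZeta k ℓ 2 ^ 2).re := by
  have h := (hasProd_partialZeta k ℓ (w := 2) (by norm_num)).pow 2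
  refine ((Complex.continuous_re.tendsto _).comp h).congr fun t => ?_
  rw [Function.comp_apply, ← Complex.ofReal_re (∏ p ∈ t, _), Complex.ofReal_prod]
  congr 1
  refine Finset.prod_congr rfl fun p _ => ?_
  push_cast
  rw [Complex.cpow_neg, Complex.cpow_ofNat, zpow_neg, zpow_ofNat]
  rw [inv_pow, one_div]

lemma ofReal_tprod_primesMod (k ℓ : ℕ) :
    ((∏' p : PrimesMod k ℓ, (1 - 1 / ((p : ℕ) : ℝ) ^ 2) ^ (-2 : ℤ) : ℝ) : ℂ) =
      partialZeta k ℓ 2 ^ 2 := by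
  have h := (hasProd_partialZeta k ℓ (w := 2) (by norm_num)).pow 2
  have hr := ((hasProd_real_partialZeta_two_sq k ℓ).map Complex.ofRealHom
    Complex.continuous_ofReal)
  rw [(hasProd_real_partialZeta_two_sq k ℓ).tprod_eq]
  refine hr.unique (h.congr_fun fun p => ?_)
  simp only [Function.comp_apply, Complex.ofRealHom_eq_coe]
  push_cast
  rw [Complex.cpow_neg, Complex.cpow_ofNat, zpow_neg, zpow_ofNat]
  rw [inv_pow, one_div]

/-! ### The value at `1` of an `L`-function as an integral -/

/-- For `s` near `1` consecutive terms `n^(-s)` differ by `O(n⁻²)`, uniformly in `s`. -/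
lemma abs_rpow_neg_sub_rpow_neg_le {a b s : ℝ} (ha : 1 ≤ a) (hab : a ≤ b) (hs1 : 1 ≤ s)
    (hs2 : s ≤ 2) : |b ^ (-s) - a ^ (-s)| ≤ 2 * (b - a) / a ^ 2 := by
  have ha0 : 0 < a := by linarith
  have hb0 : 0 < b := by linarith
  have hle : b ^ (-s) ≤ a ^ (-s) := Real.rpow_le_rpow_of_nonpos ha0 hab (by linarith)
  rw [abs_sub_comm, abs_of_nonneg (by linarith)]
  have hr0 : 0 < a / b := by positivity
  have hr1 : a / b ≤ 1 := (div_le_one hb0).mpr hab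
  have h1 : b ^ (-s) = a ^ (-s) * (a / b) ^ s := by
    rw [Real.div_rpow ha0.le hb0.le, Real.rpow_neg ha0.le, Real.rpow_neg hb0.le]
    have := (Real.rpow_pos_of_pos ha0 s).ne'
    field_simp
  have h2 : (a / b) ^ (2 : ℝ) ≤ (a / b) ^ s := Real.rpow_le_rpow_of_exponent_ge hr0 hr1 hs2
  rw [Real.rpow_two] at h2
  have h3 : a ^ (-s) ≤ a⁻¹ := by
    rw [← Real.rpow_neg_one]
    exact Real.rpow_le_rpow_of_exponent_le ha (by linarith)
  have h4 : 1 - (a / b) ^ 2 ≤ 2 * (b - a) / a := by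
    have h5 : 1 - a / b ≤ (b - a) / a := by
      rw [one_sub_div hb0.ne']
      exact div_le_div_of_nonneg_left (by linarith) ha0 hab
    rw [mul_div_assoc]
    nlinarith
  have h6 : 0 < a ^ (-s) := Real.rpow_pos_of_pos ha0 _
  calc a ^ (-s) - b ^ (-s) = a ^ (-s) * (1 - (a / b) ^ s) := by rw [h1]; ring
    _ ≤ a⁻¹ * (2 * (b - a) / a) := by
        refine mul_le_mul h3 (by linarith) ?_ (by positivity)
        linarith [Real.rpow_le_one hr0.le hr1 (by linarith : 0 ≤ s)]
    _ = 2 * (b - a) / a ^ 2 := by field_simp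

lemma tendsto_integral_mul_pow {g : ℝ → ℂ} (hg : Continuous g) :
    Tendsto (fun m : ℕ => ∫ x in (0 : ℝ)..1, g x * (x : ℂ) ^ m) atTop (𝓝 0) := by
  obtain ⟨C, hC⟩ := isCompact_Icc.exists_bound_of_continuousOn (hg.continuousOn (s := Set.Icc 0 1))
  refine squeeze_zero_norm (a := fun m : ℕ => C * (1 / ((m : ℝ) + 1))) (fun m => ?_) ?_
  · have hb : ‖∫ x in (0 : ℝ)..1, g x * (x : ℂ) ^ m‖ ≤ ∫ x in (0 : ℝ)..1, C * x ^ m := by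
      refine intervalIntegral.norm_integral_le_of_norm_le zero_le_one (Eventually.of_forall
        fun x hx => ?_) (Continuous.intervalIntegrable (by fun_prop) _ _)
      rw [norm_mul, norm_pow, Complex.norm_real, Real.norm_of_nonneg hx.1.le]
      exact mul_le_mul_of_nonneg_right (hC x ⟨hx.1.le, hx.2⟩) (pow_nonneg hx.1.le m)
    refine hb.trans_eq ?_
    rw [intervalIntegral.integral_const_mul, integral_pow]
    simp
  · simpa using tendsto_one_div_add_atTop_nhds_zero_nat.const_mul C

namespace ZMod

variable {N : ℕ} [NeZero N]

/-- The terms `N k < n ≤ N (k + 1)` of the Dirichlet series of `Φ`. -/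
noncomputable def seriesBlock (Φ : ZMod N → ℂ) (s : ℂ) (k : ℕ) : ℂ :=
  ∑ j : Fin N, Φ ((j : ℕ) + 1 : ℕ) * ((k * N + j + 1 : ℕ) : ℂ) ^ (-s)

lemma tsum_seriesBlock (Φ : ZMod N → ℂ) {s : ℂ} (hs : 1 < s.re) :
    ∑' k, seriesBlock Φ s k = LFunction Φ s := by
  have hsum := LSeriesSummable_of_one_lt_re Φ hs
  have h1 : HasSum (fun n : ℕ => LSeries.term (fun n => Φ n) s (n + 1)) (LFunction Φ s) := by
    rw [LFunction_eq_LSeries Φ hs]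
    simpa [LSeries] using (hasSum_nat_add_iff' 1).mpr hsum.hasSum
  rw [← (Nat.divModEquiv N).symm.hasSum_iff] at h1
  refine (h1.prod_fiberwise fun k => hasSum_fintype _).tsum_eq.symm ▸ ?_
  refine tsum_congr fun k => Finset.sum_congr rfl fun j _ => ?_
  simp only [Function.comp_apply, Nat.divModEquiv_symm_apply]
  rw [LSeries.term_of_ne_zero (Nat.succ_ne_zero _), Complex.cpow_neg, div_eq_mul_inv]
  push_cast
  simp

lemma sum_fin_natCast_succ (Φ : ZMod N → ℂ) :
    ∑ j : Fin N, Φ ((j : ℕ) + 1 : ℕ) = ∑ z, Φ z := by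
  refine Function.Bijective.sum_comp (e := fun j : Fin N => (((j : ℕ) + 1 : ℕ) : ZMod N))
    ((Fintype.bijective_iff_injective_and_card _).mpr ⟨fun i j hij => ?_, by simp⟩) Φ
  have h := ((ZMod.natCast_eq_natCast_iff _ _ _).mp hij).add_right_cancel'
  exact Fin.ext (h.eq_of_lt_of_lt i.2 j.2)

/-- As `Φ` sums to zero, each term may be compared with the first term of its block. -/
lemma norm_seriesBlock_le (Φ : ZMod N → ℂ) (hΦ : ∑ z, Φ z = 0) {s : ℝ}
    (hs1 : 1 ≤ s) (hs2 : s ≤ 2) (k : ℕ) :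
    ‖seriesBlock Φ s k‖ ≤
      (∑ j : Fin N, ‖Φ ((j : ℕ) + 1 : ℕ)‖ * (2 * N)) * (1 / ((k : ℝ) + 1) ^ 2) := by
  have hN : (1 : ℝ) ≤ N := by exact_mod_cast NeZero.one_le
  have hk : (0 : ℝ) ≤ k := k.cast_nonneg
  have hsplit : seriesBlock Φ s k = ∑ j : Fin N, Φ ((j : ℕ) + 1 : ℕ) *
      ((((k * N + j + 1 : ℕ) : ℝ) ^ (-s) - ((k * N + 1 : ℕ) : ℝ) ^ (-s) : ℝ) : ℂ) := by
    have h0 : ∑ j : Fin N, Φ ((j : ℕ) + 1 : ℕ) * ((((k * N + 1 : ℕ) : ℝ) ^ (-s) : ℝ) : ℂ) = 0 := by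
      rw [← Finset.sum_mul, sum_fin_natCast_succ, hΦ, zero_mul]
    rw [← sub_zero (seriesBlock Φ s k), ← h0, seriesBlock, ← Finset.sum_sub_distrib]
    refine Finset.sum_congr rfl fun j _ => ?_
    rw [← mul_sub, Complex.ofReal_sub, Complex.ofReal_cpow (Nat.cast_nonneg (k * N + j + 1))]
    push_cast
    rfl
  rw [hsplit, Finset.sum_mul]
  refine norm_sum_le_of_le _ fun j _ => ?_
  rw [norm_mul, Complex.norm_real, Real.norm_eq_abs, mul_assoc]
  refine mul_le_mul_of_nonneg_left ?_ (norm_nonneg _)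
  have ha : (1 : ℝ) ≤ ((k * N + 1 : ℕ) : ℝ) := by exact_mod_cast Nat.le_add_left 1 _
  have hj : ((j : ℕ) : ℝ) ≤ N := by exact_mod_cast j.2.le
  refine (abs_rpow_neg_sub_rpow_neg_le ha (by push_cast; linarith [(j : ℕ).cast_nonneg (α := ℝ)])
    hs1 hs2).trans ?_
  rw [div_eq_mul_one_div]
  push_cast
  have h1 : (k : ℝ) + 1 ≤ k * N + 1 := by nlinarith
  refine mul_le_mul (by linarith) ?_ (by positivity) (by positivity)
  exact one_div_le_one_div_of_le (by positivity) (by gcongr)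

lemma seriesBlock_one (Φ : ZMod N → ℂ) {g : ℝ → ℂ} (hg : Continuous g)
    (h : ∀ x : ℝ, ∑ j : Fin N, Φ ((j : ℕ) + 1 : ℕ) * (x : ℂ) ^ (j : ℕ) = g x * (1 - (x : ℂ) ^ N))
    (k : ℕ) :
    seriesBlock Φ 1 k = (∫ x in (0 : ℝ)..1, g x * (x : ℂ) ^ (k * N)) -
      ∫ x in (0 : ℝ)..1, g x * (x : ℂ) ^ ((k + 1) * N) := by
  rw [← intervalIntegral.integral_sub (Continuous.intervalIntegrable (by fun_prop) _ _)
    (Continuous.intervalIntegrable (by fun_prop) _ _)]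
  have hint : ∀ x : ℝ, g x * (x : ℂ) ^ (k * N) - g x * (x : ℂ) ^ ((k + 1) * N) =
      ∑ j : Fin N, Φ ((j : ℕ) + 1 : ℕ) * ((x ^ (k * N + j) : ℝ) : ℂ) := by
    intro x
    calc g x * (x : ℂ) ^ (k * N) - g x * (x : ℂ) ^ ((k + 1) * N)
        = g x * (1 - (x : ℂ) ^ N) * (x : ℂ) ^ (k * N) := by ring
      _ = _ := by
        rw [← h x, Finset.sum_mul]
        refine Finset.sum_congr rfl fun j _ => ?_
        push_cast
        ring
  simp_rw [hint]
  rw [intervalIntegral.integral_finsetSum fun j _ =>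
    Continuous.intervalIntegrable (by fun_prop) _ _]
  refine Finset.sum_congr rfl fun j _ => ?_
  rw [intervalIntegral.integral_const_mul, intervalIntegral.integral_ofReal, integral_pow,
    Complex.cpow_neg_one]
  push_cast
  simp

/-- The Dirichlet series converges at `1` along blocks of full periods, uniformly on `[1, 2]`; at
`1` the block sums telescope after the substitution `1 / n = ∫₀¹ xⁿ⁻¹`. -/
theorem LFunction_one_eq_integral (Φ : ZMod N → ℂ) {g : ℝ → ℂ} (hg : Continuous g)
    (h : ∀ x : ℝ, ∑ j : Fin N, Φ ((j : ℕ) + 1 : ℕ) * (x : ℂ) ^ (j : ℕ) = g x * (1 - (x : ℂ) ^ N)) :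
    LFunction Φ 1 = ∫ x in (0 : ℝ)..1, g x := by
  have hΦ : ∑ z, Φ z = 0 := by
    rw [← sum_fin_natCast_succ]
    simpa using h 1
  set C := ∑ j : Fin N, ‖Φ ((j : ℕ) + 1 : ℕ)‖ * (2 * N)
  have hbound : Summable fun k : ℕ => C * (1 / ((k : ℝ) + 1) ^ 2) := by
    refine Summable.mul_left C ?_
    exact_mod_cast (summable_nat_add_iff 1).mpr (Real.summable_one_div_nat_pow.mpr one_lt_two)
  have hlim : Tendsto (fun s : ℝ => ∑' k, seriesBlock Φ s k) (𝓝[>] 1)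
      (𝓝 (∑' k, seriesBlock Φ 1 k)) := by
    refine tendsto_tsum_of_dominated_convergence hbound (fun k => ?_) ?_
    · refine Tendsto.mono_left ?_ nhdsWithin_le_nhds
      have hc : Continuous fun s : ℝ => seriesBlock Φ s k := by
        unfold seriesBlock
        refine continuous_finsetSum _ fun j _ => continuous_const.mul ?_
        refine (Complex.continuous_ofReal.neg).const_cpow (Or.inl ?_)
        exact Nat.cast_ne_zero.mpr (Nat.succ_ne_zero (k * N + j))
      simpa using hc.tendsto 1
    · filter_upwards [Ioc_mem_nhdsGT (one_lt_two : (1 : ℝ) < 2)] with s hs k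
      exact norm_seriesBlock_le Φ hΦ hs.1.le hs.2 k
  have hL : Tendsto (fun s : ℝ => ∑' k, seriesBlock Φ s k) (𝓝[>] 1) (𝓝 (LFunction Φ 1)) := by
    have hc : Continuous fun s : ℝ => LFunction Φ s :=
      (differentiable_LFunction_of_sum_zero hΦ).continuous.comp Complex.continuous_ofReal
    have ht := (hc.tendsto 1).mono_left (nhdsWithin_le_nhds (s := Set.Ioi 1))
    rw [Complex.ofReal_one] at ht
    refine ht.congr' ?_
    filter_upwards [self_mem_nhdsWithin] with s hs
    exact (tsum_seriesBlock Φ (by simpa using hs)).symm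
  have hsum : Summable (seriesBlock Φ 1) := by
    refine .of_norm_bounded hbound fun k => ?_
    have hk := norm_seriesBlock_le Φ hΦ le_rfl one_le_two k
    rwa [Complex.ofReal_one] at hk
  refine tendsto_nhds_unique hL hlim |>.trans (tendsto_nhds_unique hsum.hasSum.tendsto_sum_nat ?_)
  have htel (K : ℕ) : ∑ k ∈ Finset.range K, seriesBlock Φ 1 k =
      (∫ x in (0 : ℝ)..1, g x) - ∫ x in (0 : ℝ)..1, g x * (x : ℂ) ^ (K * N) := by
    simp_rw [seriesBlock_one Φ hg h]
    rw [Finset.sum_range_sub' (fun k => ∫ x in (0 : ℝ)..1, g x * (x : ℂ) ^ (k * N))]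
    simp
  simp_rw [htel]
  have hKN : Tendsto (fun K : ℕ => K * N) atTop atTop :=
    tendsto_id.atTop_mul_const' (NeZero.pos N)
  simpa using ((tendsto_integral_mul_pow hg).comp hKN).const_sub (∫ x in (0 : ℝ)..1, g x)

end ZMod

/-! ### Two definite integrals -/

lemma quadratic_cos_pos {α : ℝ} (hα : Real.sin α ≠ 0) (x : ℝ) :
    0 < x ^ 2 + 2 * Real.cos α * x + 1 := by
  have h1 := Real.sin_sq_add_cos_sq α
  have h2 : 0 < Real.sin α ^ 2 := by positivity
  nlinarith [sq_nonneg (x + Real.cos α)]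

/-- The antiderivative is `arctan ((x + cos α) / sin α) / sin α`, whose arctangents at `0` and `1`
are `π / 2 - α` and `π / 2 - α / 2`. -/
lemma integral_inv_quadratic_cos {α : ℝ} (h0 : 0 < α) (hπ : α < Real.pi) :
    ∫ x in (0 : ℝ)..1, (x ^ 2 + 2 * Real.cos α * x + 1)⁻¹ = α / (2 * Real.sin α) := by
  have hs := Real.sin_pos_of_pos_of_lt_pi h0 hπ
  have hcot {β : ℝ} (hβ0 : 0 < β) (hβ : β < Real.pi) :
      Real.arctan (Real.cos β / Real.sin β) = Real.pi / 2 - β := by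
    rw [← inv_div, ← Real.tan_eq_sin_div_cos, ← Real.tan_pi_div_two_sub,
      Real.arctan_tan (by linarith) (by linarith)]
  have hderiv (x : ℝ) : HasDerivAt
      (fun x => Real.arctan ((x + Real.cos α) / Real.sin α) / Real.sin α)
      (x ^ 2 + 2 * Real.cos α * x + 1)⁻¹ x := by
    have hd := (((hasDerivAt_id x).add_const (Real.cos α)).div_const (Real.sin α)).arctan.div_const
      (Real.sin α)
    refine hd.congr_deriv ?_
    have hq := quadratic_cos_pos hs.ne' x
    have hq' : x ^ 2 + 2 * Real.cos α * x + 1 = Real.sin α ^ 2 + (x + Real.cos α) ^ 2 := by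
      linear_combination -Real.sin_sq_add_cos_sq α
    rw [hq'] at hq ⊢
    simp only [id]
    field_simp
  rw [intervalIntegral.integral_eq_sub_of_hasDerivAt (fun x _ => hderiv x)
    (Continuous.intervalIntegrable
      (Continuous.inv₀ (by fun_prop) fun x => (quadratic_cos_pos hs.ne' x).ne') _ _)]
  have h1 : (1 + Real.cos α) / Real.sin α = Real.cos (α / 2) / Real.sin (α / 2) := by
    have hs2 := Real.sin_pos_of_pos_of_lt_pi (half_pos h0) (by linarith)
    have hsin : Real.sin α = 2 * Real.sin (α / 2) * Real.cos (α / 2) := by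
      rw [← Real.sin_two_mul]; ring_nf
    have hcos : Real.cos α = 2 * Real.cos (α / 2) ^ 2 - 1 := by
      rw [← Real.cos_two_mul]; ring_nf
    have hc2 := Real.cos_pos_of_mem_Ioo (x := α / 2) ⟨by linarith, by linarith⟩
    rw [hsin, hcos]
    field_simp
    ring
  rw [h1, zero_add, hcot h0 hπ, hcot (half_pos h0) (by linarith)]
  field_simp
  ring

lemma two_mul_cos_pi_div_five : 2 * Real.cos (Real.pi / 5) = (1 + √5) / 2 := by
  rw [Real.cos_pi_div_five]; ring

lemma cos_two_pi_div_five : Real.cos (2 * Real.pi / 5) = (√5 - 1) / 4 := by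
  rw [mul_div_assoc, Real.cos_two_mul, Real.cos_pi_div_five]
  have h5 : √5 ^ 2 = (5 : ℝ) := Real.sq_sqrt (by norm_num)
  linear_combination h5 / 8

lemma two_mul_cos_three_pi_div_five : 2 * Real.cos (3 * Real.pi / 5) = (1 - √5) / 2 := by
  rw [show 3 * Real.pi / 5 = Real.pi - 2 * Real.pi / 5 by ring, Real.cos_pi_sub,
    cos_two_pi_div_five]
  ring

lemma sin_three_pi_div_five :
    Real.sin (3 * Real.pi / 5) = (1 + √5) / 2 * Real.sin (Real.pi / 5) := by
  rw [show 3 * Real.pi / 5 = Real.pi - 2 * (Real.pi / 5) by ring, Real.sin_pi_sub,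
    Real.sin_two_mul, Real.cos_pi_div_five]
  ring

lemma sin_pi_div_five_pos : 0 < Real.sin (Real.pi / 5) :=
  Real.sin_pos_of_pos_of_lt_pi (by positivity) (by linarith [Real.pi_pos])

lemma quadratic_golden_pos (x : ℝ) :
    0 < x ^ 2 + (1 + √5) / 2 * x + 1 ∧ 0 < x ^ 2 + (1 - √5) / 2 * x + 1 := by
  rw [← two_mul_cos_pi_div_five, ← two_mul_cos_three_pi_div_five]
  refine ⟨quadratic_cos_pos sin_pi_div_five_pos.ne' x, quadratic_cos_pos ?_ x⟩
  rw [sin_three_pi_div_five]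
  have := sin_pi_div_five_pos
  positivity

lemma cyclotomic_five_factor (x : ℝ) :
    (x ^ 2 + (1 + √5) / 2 * x + 1) * (x ^ 2 + (1 - √5) / 2 * x + 1) =
      1 + x + x ^ 2 + x ^ 3 + x ^ 4 := by
  have h5 : √5 ^ 2 = (5 : ℝ) := Real.sq_sqrt (by norm_num)
  linear_combination -x ^ 2 / 4 * h5

lemma cyclotomic_five_pos (x : ℝ) : 0 < 1 + x + x ^ 2 + x ^ 3 + x ^ 4 := by
  rw [← cyclotomic_five_factor]
  exact mul_pos (quadratic_golden_pos x).1 (quadratic_golden_pos x).2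

lemma integral_inv_quadratic_golden :
    (∫ x in (0 : ℝ)..1, (x ^ 2 + (1 + √5) / 2 * x + 1)⁻¹) =
        Real.pi / (10 * Real.sin (Real.pi / 5)) ∧
      (∫ x in (0 : ℝ)..1, (x ^ 2 + (1 - √5) / 2 * x + 1)⁻¹) =
        3 * Real.pi * (√5 - 1) / (20 * Real.sin (Real.pi / 5)) := by
  have hπ := Real.pi_pos
  have hs := sin_pi_div_five_pos
  rw [← two_mul_cos_pi_div_five, ← two_mul_cos_three_pi_div_five]
  rw [integral_inv_quadratic_cos (by positivity) (by linarith),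
    integral_inv_quadratic_cos (by positivity) (by linarith), sin_three_pi_div_five]
  have h5 : √5 ^ 2 = (5 : ℝ) := Real.sq_sqrt (by norm_num)
  constructor <;> field_simp
  · norm_num
  · linear_combination -5 * h5

/-- By partial fractions over `ℚ(√5)`. -/
lemma integral_quadratic_div_cyclotomic_five (c : ℂ) :
    ∫ x in (0 : ℝ)..1, (1 + (1 + c) * x + x ^ 2) / (1 + x + x ^ 2 + x ^ 3 + x ^ 4 : ℂ) =
      (Real.pi / (10 * √5 * Real.sin (Real.pi / 5)) : ℝ) *
        (((5 + √5) / 2 : ℝ) + c * ((3 * √5 - 5) / 2 : ℝ)) := by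
  have h5 : √5 ^ 2 = (5 : ℝ) := Real.sq_sqrt (by norm_num)
  have h50 : √5 ≠ 0 := by positivity
  have hs := sin_pi_div_five_pos
  have hcont₁ : Continuous fun x : ℝ => (x ^ 2 + (1 + √5) / 2 * x + 1)⁻¹ :=
    Continuous.inv₀ (by fun_prop) fun x => (quadratic_golden_pos x).1.ne'
  have hcont₂ : Continuous fun x : ℝ => (x ^ 2 + (1 - √5) / 2 * x + 1)⁻¹ :=
    Continuous.inv₀ (by fun_prop) fun x => (quadratic_golden_pos x).2.ne'
  have hpf (x : ℝ) : (1 + (1 + c) * x + x ^ 2) / (1 + x + x ^ 2 + x ^ 3 + x ^ 4 : ℂ) =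
      (((√5 - 1) / (2 * √5) : ℝ) - c * (1 / √5 : ℝ)) *
          ((x ^ 2 + (1 + √5) / 2 * x + 1)⁻¹ : ℝ) +
        (((√5 + 1) / (2 * √5) : ℝ) + c * (1 / √5 : ℝ)) *
          ((x ^ 2 + (1 - √5) / 2 * x + 1)⁻¹ : ℝ) := by
    have h1 := (quadratic_golden_pos x).1.ne'
    have h2 := (quadratic_golden_pos x).2.ne'
    have hA : (1 + x + x ^ 2) / (1 + x + x ^ 2 + x ^ 3 + x ^ 4) =
        (√5 - 1) / (2 * √5) * (x ^ 2 + (1 + √5) / 2 * x + 1)⁻¹ +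
        (√5 + 1) / (2 * √5) * (x ^ 2 + (1 - √5) / 2 * x + 1)⁻¹ := by
      rw [← cyclotomic_five_factor]
      generalize hP : x ^ 2 + (1 + √5) / 2 * x + 1 = P at *
      generalize hQ : x ^ 2 + (1 - √5) / 2 * x + 1 = Q at *
      field_simp
      rw [← hP, ← hQ]
      ring
    have hB : x / (1 + x + x ^ 2 + x ^ 3 + x ^ 4) =
        1 / √5 * ((x ^ 2 + (1 - √5) / 2 * x + 1)⁻¹ - (x ^ 2 + (1 + √5) / 2 * x + 1)⁻¹) := by
      rw [← cyclotomic_five_factor]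
      generalize hP : x ^ 2 + (1 + √5) / 2 * x + 1 = P at *
      generalize hQ : x ^ 2 + (1 - √5) / 2 * x + 1 = Q at *
      field_simp
      rw [← hP, ← hQ]
      ring
    have hA' := congrArg (fun r : ℝ => (r : ℂ)) hA
    have hB' := congrArg (fun r : ℝ => (r : ℂ)) hB
    push_cast at hA' hB' ⊢
    linear_combination hA' + c * hB'
  simp_rw [hpf]
  rw [intervalIntegral.integral_add, intervalIntegral.integral_const_mul,
    intervalIntegral.integral_const_mul, intervalIntegral.integral_ofReal,
    intervalIntegral.integral_ofReal, integral_inv_quadratic_golden.1,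
    integral_inv_quadratic_golden.2]
  · have h5' : (√5 : ℂ) ^ 2 = 5 := by exact_mod_cast congrArg (fun r : ℝ => (r : ℂ)) h5
    have h50' : (√5 : ℂ) ≠ 0 := by exact_mod_cast h50
    have hs' : (Complex.sin (Real.pi / 5) : ℂ) ≠ 0 := by exact_mod_cast hs.ne'
    push_cast
    field_simp
    linear_combination 30 * h5'
  · exact (continuous_const.mul (Complex.continuous_ofReal.comp hcont₁)).intervalIntegrable _ _
  · exact (continuous_const.mul (Complex.continuous_ofReal.comp hcont₂)).intervalIntegrable _ _

/-- The value is `log φ² / √5` for the golden ratio `φ`, and `φ³ = 2 + √5`. -/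
lemma integral_one_sub_sq_div_cyclotomic_five :
    ∫ x in (0 : ℝ)..1, (1 - x ^ 2) / (1 + x + x ^ 2 + x ^ 3 + x ^ 4) =
      2 * Real.log (2 + √5) / (3 * √5) := by
  have h5 : √5 ^ 2 = (5 : ℝ) := Real.sq_sqrt (by norm_num)
  have h50 : 0 < √5 := by positivity
  have h51 : √5 < 5 := by nlinarith
  have hderiv (x : ℝ) : HasDerivAt (fun x => (Real.log (x ^ 2 + (1 + √5) / 2 * x + 1) -
      Real.log (x ^ 2 + (1 - √5) / 2 * x + 1)) / √5)
      ((1 - x ^ 2) / (1 + x + x ^ 2 + x ^ 3 + x ^ 4)) x := by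
    obtain ⟨h1, h2⟩ := quadratic_golden_pos x
    have hd (b : ℝ) : HasDerivAt (fun x => x ^ 2 + b * x + 1) (2 * x + b) x := by
      simpa using (((hasDerivAt_id x).pow 2).add ((hasDerivAt_id x).const_mul b)).add_const 1
    refine ((((hd _).log h1.ne').sub ((hd _).log h2.ne')).div_const √5).congr_deriv ?_
    rw [← cyclotomic_five_factor]
    generalize hP : x ^ 2 + (1 + √5) / 2 * x + 1 = P at *
    generalize hQ : x ^ 2 + (1 - √5) / 2 * x + 1 = Q at *
    field_simp
    rw [← hP, ← hQ]
    ring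
  rw [intervalIntegral.integral_eq_sub_of_hasDerivAt (fun x _ => hderiv x)
    (Continuous.intervalIntegrable
      (Continuous.div (by fun_prop) (by fun_prop) fun x => (cyclotomic_five_pos x).ne') _ _)]
  have hφ : Real.log (2 + √5) = 3 * Real.log ((1 + √5) / 2) := by
    rw [show (3 : ℝ) * Real.log ((1 + √5) / 2) = Real.log (((1 + √5) / 2) ^ 3) by
      rw [Real.log_pow]; norm_num]
    congr 1
    linear_combination (-(√5 + 3) / 8) * h5
  have hlog : Real.log (1 ^ 2 + (1 + √5) / 2 * 1 + 1) =
      Real.log (1 ^ 2 + (1 - √5) / 2 * 1 + 1) + 2 * Real.log ((1 + √5) / 2) := by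
    rw [show (2 : ℝ) * Real.log ((1 + √5) / 2) = Real.log (((1 + √5) / 2) ^ 2) by
      rw [Real.log_pow]; norm_num, ← Real.log_mul (by linarith) (by positivity)]
    congr 1
    linear_combination ((√5 - 3) / 8) * h5
  rw [hlog, hφ]
  simp only [ne_eq, OfNat.ofNat_ne_zero, not_false_eq_true, zero_pow, mul_zero, zero_add,
    Real.log_one]
  field_simp
  ring

/-! ### Fourth roots -/

/-- A fourth root is principal as soon as it and its square lie in the right half-plane: the
principal fourth root is an iterated principal square root. -/
lemma cpow_quarter_eq {z w : ℂ} (hz : 0 < z.re) (hz2 : 0 < (z ^ 2).re) (h : (z ^ 2) ^ 2 = w) :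
    w ^ (1 / 4 : ℂ) = z := by
  have hroot {v : ℂ} (hv : 0 < v.re) : (v ^ 2) ^ (1 / 2 : ℂ) = v := by
    have habs := abs_lt.mp (Complex.abs_arg_lt_pi_div_two_iff.mpr (Or.inl hv))
    simpa using Complex.pow_cpow_nat_inv (n := 2) two_ne_zero (by simpa using habs.1)
      (by simpa using habs.2.le)
  have hmul : w ^ (1 / 4 : ℂ) = (w ^ (1 / 2 : ℂ)) ^ (1 / 2 : ℂ) := by
    have him : (Complex.log w * (1 / 2 : ℂ)).im = w.arg / 2 := by
      rw [show (1 / 2 : ℂ) = ((1 / 2 : ℝ) : ℂ) by push_cast; rfl, Complex.im_mul_ofReal,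
        Complex.log_im]
      ring
    rw [← Complex.cpow_mul]
    · norm_num
    · rw [him]; linarith [Complex.neg_pi_lt_arg w, Real.pi_pos]
    · rw [him]; linarith [Complex.arg_le_pi w, Real.pi_pos]
  rw [hmul, ← h, hroot hz2, hroot hz]

/-- For `c = ±i`: the principal fourth root of `3 + 4c = (2 + c)²` in Cartesian form. -/
lemma cpow_quarter_three_add_four {c : ℂ} (hre : c.re = 0) (hc : c ^ 2 = -1) :
    (3 + 4 * c) ^ (1 / 4 : ℂ) = √((√5 + 2) / 2) * (1 + (√5 - 2) * c) := by
  have h5 : √5 ^ 2 = (5 : ℝ) := Real.sq_sqrt (by norm_num)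
  have ha : √((√5 + 2) / 2) ^ 2 = (√5 + 2) / 2 := Real.sq_sqrt (by positivity)
  have h5' : (√5 : ℂ) ^ 2 = 5 := by exact_mod_cast congrArg (fun r : ℝ => (r : ℂ)) h5
  have ha' : (√((√5 + 2) / 2) : ℂ) ^ 2 = (√5 + 2) / 2 := by
    exact_mod_cast congrArg (fun r : ℝ => (r : ℂ)) ha
  have hsq : ((√((√5 + 2) / 2) : ℂ) * (1 + (√5 - 2) * c)) ^ 2 = 2 + c := by
    rw [mul_pow, ha']
    linear_combination ((√5 + 2) / 2 * (√5 - 2) ^ 2) * hc + (c + 1 - √5 / 2) * h5'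
  refine cpow_quarter_eq ?_ ?_ ?_
  · have hr : ((√((√5 + 2) / 2) : ℂ) * (1 + (√5 - 2) * c)).re = √((√5 + 2) / 2) := by
      rw [Complex.re_ofReal_mul, ← Complex.ofReal_ofNat, ← Complex.ofReal_sub, Complex.add_re,
        Complex.re_ofReal_mul, hre]
      simp
    rw [hr]
    positivity
  · rw [hsq, Complex.add_re, hre]
    norm_num
  · rw [hsq]
    linear_combination hc

lemma sq_two_rpow_half : ((2 : ℝ) ^ (1 / 2 : ℝ)) ^ 2 = 2 := by
  rw [← Real.sqrt_eq_rpow]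
  exact Real.sq_sqrt (by norm_num)

lemma sq_five_rpow : ((5 : ℝ) ^ (-(5 / 4) : ℝ)) ^ 2 = √5 / 125 := by
  rw [← Real.rpow_natCast, ← Real.rpow_mul (by norm_num), Real.sqrt_eq_rpow,
    show (-(5 / 4) : ℝ) * (2 : ℕ) = 1 / 2 - (3 : ℕ) by norm_num,
    Real.rpow_sub (by norm_num), Real.rpow_natCast]
  norm_num

/-- The constant of the arctangent integral, matched with the absolute value of the fourth root
through `sin² (π / 5) = (5 - √5) / 8`. -/
lemma pi_div_sin_pi_div_five :
    Real.pi / (10 * √5 * Real.sin (Real.pi / 5)) * ((5 + √5) / 2) =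
      2 ^ (1 / 2 : ℝ) * 5 ^ (-(5 / 4) : ℝ) * Real.pi * √((√5 + 2) / 2) := by
  have h5 : √5 ^ 2 = (5 : ℝ) := Real.sq_sqrt (by norm_num)
  have hs := sin_pi_div_five_pos
  have hs2 : Real.sin (Real.pi / 5) ^ 2 = (5 - √5) / 8 := by
    have h := Real.sin_sq_add_cos_sq (Real.pi / 5)
    rw [Real.cos_pi_div_five] at h
    linear_combination h - h5 / 16
  have ha : √((√5 + 2) / 2) ^ 2 = (√5 + 2) / 2 := Real.sq_sqrt (by positivity)
  refine (sq_eq_sq₀ (by positivity) (by positivity)).mp ?_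
  have hne : 5 - √5 ≠ 0 := by
    intro h
    rw [h] at hs2
    simp [hs.ne'] at hs2
  have key : (5 + √5) ^ 2 = 2 * √5 * (√5 + 2) * (5 - √5) := by
    linear_combination (2 * √5 - 5) * h5
  calc (Real.pi / (10 * √5 * Real.sin (Real.pi / 5)) * ((5 + √5) / 2)) ^ 2
      = Real.pi ^ 2 * (5 + √5) ^ 2 / (400 * √5 ^ 2 * Real.sin (Real.pi / 5) ^ 2) := by
        field_simp
        norm_num
    _ = 2 * (√5 / 125) * Real.pi ^ 2 * ((√5 + 2) / 2) := by
        rw [hs2, h5, key]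
        field_simp
        norm_num
    _ = (2 ^ (1 / 2 : ℝ) * 5 ^ (-(5 / 4) : ℝ) * Real.pi * √((√5 + 2) / 2)) ^ 2 := by
        rw [mul_pow, mul_pow, mul_pow, sq_two_rpow_half, sq_five_rpow, ha]

/-! ### The quartic character modulo 5 -/

lemma isUnit_zmod_five {z : ZMod 5} (hz : z ≠ 0) : IsUnit z :=
  haveI : Fact (Nat.Prime 5) := ⟨by norm_num⟩
  isUnit_iff_ne_zero.mpr hz

/-- The Dirichlet character modulo `5` with `2 ↦ i`, given by its values at `0, 1, 2, 3, 4`. -/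
noncomputable def quarticMod5 : DirichletCharacter ℂ 5 where
  toFun x := ![0, 1, Complex.I, -Complex.I, -1] x
  map_one' := rfl
  map_mul' x y := by
    fin_cases x <;> fin_cases y <;> norm_num <;> rfl
  map_nonunit' x hx := by
    have h : x = 0 := by
      by_contra h0
      exact hx (isUnit_zmod_five h0)
    rw [h]; rfl

lemma quarticMod5_zero : quarticMod5 0 = 0 := rfl
lemma quarticMod5_one : quarticMod5 1 = 1 := rfl
lemma quarticMod5_two : quarticMod5 2 = Complex.I := rfl
lemma quarticMod5_three : quarticMod5 3 = -Complex.I := rfl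
lemma quarticMod5_four : quarticMod5 4 = -1 := rfl

lemma zmod_five_cases (z : ZMod 5) : z = 0 ∨ z = 1 ∨ z = 2 ∨ z = 3 ∨ z = 4 := by
  revert z; decide

lemma quarticMod5_pow_four : quarticMod5 ^ 4 = 1 := by
  refine MulChar.ext fun u => ?_
  rw [MulChar.pow_apply_coe, MulChar.one_apply_coe]
  rcases zmod_five_cases u with h | h | h | h | h
  · have : Nontrivial (ZMod 5) := ⟨0, 1, by decide⟩
    exact absurd h u.ne_zero
  all_goals rw [h]
  · rw [quarticMod5_one, one_pow]
  · rw [quarticMod5_two, Complex.I_pow_four]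
  · rw [quarticMod5_three]; norm_num [Complex.I_pow_four, neg_pow]
  · rw [quarticMod5_four]; norm_num

lemma quarticMod5_sq_apply (z : ZMod 5) : (quarticMod5 ^ 2) z = quarticMod5 z ^ 2 :=
  MulChar.pow_apply' _ two_ne_zero _

lemma quarticMod5_cube_apply (z : ZMod 5) : (quarticMod5 ^ 3) z = quarticMod5 z ^ 3 :=
  MulChar.pow_apply' _ three_ne_zero _

lemma quarticMod5_sq_ne_one : quarticMod5 ^ 2 ≠ 1 := by
  intro h
  have h2 : (quarticMod5 ^ 2) 2 = (1 : DirichletCharacter ℂ 5) 2 := by rw [h]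
  rw [quarticMod5_sq_apply, quarticMod5_two, Complex.I_sq,
    MulChar.one_apply (isUnit_zmod_five (by decide))] at h2
  norm_num at h2

lemma quarticMod5_apply_of_ne_one {z : ZMod 5} (hz : z ≠ 1) : quarticMod5 z = 0 ∨
    quarticMod5 z = -1 ∨ quarticMod5 z = Complex.I ∨ quarticMod5 z = -Complex.I := by
  rcases zmod_five_cases z with rfl | rfl | rfl | rfl | rfl
  · exact .inl quarticMod5_zero
  · exact absurd rfl hz
  · exact .inr (.inr (.inl quarticMod5_two))
  · exact .inr (.inr (.inr quarticMod5_three))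
  · exact .inr (.inl quarticMod5_four)

lemma isFaithfulQuartic_quarticMod5 : IsFaithfulQuartic quarticMod5 where
  pow_four := quarticMod5_pow_four
  sq_ne_one := quarticMod5_sq_ne_one
  apply_of_modEq p hp := by
    rw [(ZMod.natCast_eq_natCast_iff _ _ _).mpr hp, Nat.cast_one, quarticMod5_one]
  apply_of_not_modEq p hp := quarticMod5_apply_of_ne_one fun h =>
    hp ((ZMod.natCast_eq_natCast_iff _ _ _).mp (by rw [h, Nat.cast_one]))

/-! ### Values of `L`-functions modulo 5 -/

/-- The odd quartic characters are the cases `c = ±i`. -/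
lemma LFunction_one_of_values_mod_five (Φ : ZMod 5 → ℂ) (c : ℂ) (h0 : Φ 0 = 0) (h1 : Φ 1 = 1)
    (h2 : Φ 2 = c) (h3 : Φ 3 = -c) (h4 : Φ 4 = -1) :
    ZMod.LFunction Φ 1 = (Real.pi / (10 * √5 * Real.sin (Real.pi / 5)) : ℝ) *
        (((5 + √5) / 2 : ℝ) + c * ((3 * √5 - 5) / 2 : ℝ)) := by
  have hne (x : ℝ) : (1 + x + x ^ 2 + x ^ 3 + x ^ 4 : ℂ) ≠ 0 := by
    exact_mod_cast (cyclotomic_five_pos x).ne'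
  rw [← integral_quadratic_div_cyclotomic_five]
  refine ZMod.LFunction_one_eq_integral Φ
    (Continuous.div (by fun_prop) (by fun_prop) hne) fun x => ?_
  -- The block runs over the arguments `1, …, 5`, and `5 = 0` in `ZMod 5`.
  have h5 : Φ ((5 : ℕ) : ZMod 5) = 0 := h0
  have h1' : Φ ((1 : ℕ) : ZMod 5) = 1 := h1
  have h2' : Φ ((2 : ℕ) : ZMod 5) = c := h2
  have h3' : Φ ((3 : ℕ) : ZMod 5) = -c := h3
  have h4' : Φ ((4 : ℕ) : ZMod 5) = -1 := h4
  simp only [Fin.sum_univ_five, Fin.coe_ofNat_eq_mod,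
    Nat.reduceMod, Nat.reduceAdd, h1', h2', h3', h4', h5]
  rw [div_mul_eq_mul_div, eq_div_iff (hne x)]
  ring

lemma quarticMod5_sq_LFunction_one :
    (quarticMod5 ^ 2).LFunction 1 = ((2 * Real.log (2 + √5) / (3 * √5) : ℝ) : ℂ) := by
  have hne (x : ℝ) : (1 + x + x ^ 2 + x ^ 3 + x ^ 4 : ℂ) ≠ 0 := by
    exact_mod_cast (cyclotomic_five_pos x).ne'
  rw [← integral_one_sub_sq_div_cyclotomic_five, ← intervalIntegral.integral_ofReal]
  refine ZMod.LFunction_one_eq_integral _ (Complex.continuous_ofReal.comp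
    (Continuous.div (by fun_prop) (by fun_prop) fun x => (cyclotomic_five_pos x).ne')) fun x => ?_
  have h5 : quarticMod5 ((5 : ℕ) : ZMod 5) = 0 := quarticMod5_zero
  have h1' : quarticMod5 ((1 : ℕ) : ZMod 5) = 1 := quarticMod5_one
  have h2' : quarticMod5 ((2 : ℕ) : ZMod 5) = Complex.I := quarticMod5_two
  have h3' : quarticMod5 ((3 : ℕ) : ZMod 5) = -Complex.I := quarticMod5_three
  have h4' : quarticMod5 ((4 : ℕ) : ZMod 5) = -1 := quarticMod5_four
  simp only [quarticMod5_sq_apply, Fin.sum_univ_five, Fin.coe_ofNat_eq_mod, Nat.reduceMod,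
    Nat.reduceAdd, h1', h2', h3', h4', h5, neg_sq, Complex.I_sq]
  push_cast
  rw [div_mul_eq_mul_div, eq_div_iff (hne x)]
  ring

/-- The finite Fourier expansion of the quadratic character modulo `5`. -/
lemma quarticMod5_sq_fourier (n : ℕ) : (quarticMod5 ^ 2) n =
    ((2 / √5 * (Real.cos (2 * Real.pi * n * (1 / 5)) - Real.cos (2 * Real.pi * n * (2 / 5))) : ℝ) :
      ℂ) := by
  have h50 : √5 ≠ 0 := by positivity
  -- The cosines depend only on `n % 5`, so that five cases remain.
  have hmod (c : ℝ) (j m : ℕ) (hc : c = (j : ℝ) / 5) :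
      Real.cos (2 * Real.pi * m * c) = Real.cos (2 * Real.pi * (m % 5 : ℕ) * c) := by
    have hm : (m : ℝ) = (m % 5 : ℕ) + 5 * (m / 5 : ℕ) := by
      exact_mod_cast (Nat.mod_add_div m 5).symm
    rw [hm, hc, ← Real.cos_add_nat_mul_two_pi (2 * Real.pi * (m % 5 : ℕ) * ((j : ℝ) / 5))
      (j * (m / 5))]
    congr 1
    push_cast
    ring
  have h50' : (√5 : ℂ) ≠ 0 := by exact_mod_cast h50
  have hc1 := Real.cos_pi_div_five
  have hc2 := cos_two_pi_div_five
  rw [hmod (1 / 5) 1 n (by norm_num), hmod (2 / 5) 2 n (by norm_num), ← ZMod.natCast_mod n 5,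
    quarticMod5_sq_apply]
  have hlt : n % 5 < 5 := Nat.mod_lt _ (by norm_num)
  generalize n % 5 = r at hlt
  have e0 : Real.cos (2 * Real.pi * (1 / 5)) = (√5 - 1) / 4 := by rw [← hc2]; congr 1; ring
  have e1 : Real.cos (2 * Real.pi * (2 / 5)) = -((1 + √5) / 4) := by
    rw [← hc1, ← Real.cos_pi_sub]; congr 1; ring
  have e2 : Real.cos (2 * Real.pi * 2 * (1 / 5)) = -((1 + √5) / 4) := by
    rw [← hc1, ← Real.cos_pi_sub]; congr 1; ring
  have e3 : Real.cos (2 * Real.pi * 2 * (2 / 5)) = (√5 - 1) / 4 := by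
    rw [← hc2, ← Real.cos_two_pi_sub]; congr 1; ring
  have e4 : Real.cos (2 * Real.pi * 3 * (1 / 5)) = -((1 + √5) / 4) := by
    rw [← hc1, ← Real.cos_add_pi]; congr 1; ring
  have e5 : Real.cos (2 * Real.pi * 3 * (2 / 5)) = (√5 - 1) / 4 := by
    rw [show 2 * Real.pi * 3 * (2 / 5) = 2 * Real.pi / 5 + 2 * Real.pi by ring,
      Real.cos_add_two_pi, hc2]
  have e6 : Real.cos (2 * Real.pi * 4 * (1 / 5)) = (√5 - 1) / 4 := by
    rw [← hc2, ← Real.cos_two_pi_sub]; congr 1; ring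
  have e7 : Real.cos (2 * Real.pi * 4 * (2 / 5)) = -((1 + √5) / 4) := by
    rw [show 2 * Real.pi * 4 * (2 / 5) = Real.pi / 5 + Real.pi + 2 * Real.pi by ring,
      Real.cos_add_two_pi, Real.cos_add_pi, hc1]
  interval_cases r
  · simp [quarticMod5_zero]
  · rw [Nat.cast_one, Nat.cast_one, mul_one, e0, e1, quarticMod5_one]
    push_cast
    field_simp
    ring
  · rw [Nat.cast_ofNat, Nat.cast_ofNat, e2, e3, quarticMod5_two, Complex.I_sq]
    push_cast
    field_simp
    ring
  · rw [Nat.cast_ofNat, Nat.cast_ofNat, e4, e5, quarticMod5_three, neg_sq, Complex.I_sq]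
    push_cast
    field_simp
    ring
  · rw [Nat.cast_ofNat, Nat.cast_ofNat, e6, e7, quarticMod5_four]
    push_cast
    field_simp
    ring

lemma quarticMod5_sq_LFunction_two :
    (quarticMod5 ^ 2).LFunction 2 = ((4 * Real.pi ^ 2 * √5 / 125 : ℝ) : ℂ) := by
  have h5 : √5 ^ 2 = (5 : ℝ) := Real.sq_sqrt (by norm_num)
  have hB (x : ℝ) (hx : x ∈ Set.Icc (0 : ℝ) 1) :
      HasSum (fun n : ℕ => 1 / (n : ℝ) ^ 2 * Real.cos (2 * Real.pi * n * x))
        (Real.pi ^ 2 * (x ^ 2 - x + 1 / 6)) := by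
    have h := hasSum_one_div_nat_pow_mul_cos (k := 1) one_ne_zero hx
    convert h using 1
    simp [Polynomial.bernoulli, Finset.sum_range_succ, Polynomial.eval_monomial, bernoulli]
    ring
  have hs := ((hB (1 / 5) (by constructor <;> norm_num)).sub
    (hB (2 / 5) (by constructor <;> norm_num))).mul_left (2 / √5)
  have hs' := Complex.hasSum_ofReal.mpr hs
  rw [(quarticMod5 ^ 2).LFunction_eq_LSeries (by norm_num), LSeries]
  refine HasSum.tsum_eq ?_
  convert hs' using 1
  · funext n
    rcases eq_or_ne n 0 with rfl | hn
    · simp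
    · rw [LSeries.term_of_ne_zero hn, quarticMod5_sq_fourier]
      push_cast
      rw [Complex.cpow_ofNat]
      ring
  · congr 1
    field_simp
    linear_combination 600 * h5

lemma LFunction_one_of_values_mod_five_eq_cpow (Φ : ZMod 5 → ℂ) {c : ℂ} (hre : c.re = 0)
    (hc : c ^ 2 = -1) (h0 : Φ 0 = 0) (h1 : Φ 1 = 1) (h2 : Φ 2 = c) (h3 : Φ 3 = -c)
    (h4 : Φ 4 = -1) :
    ZMod.LFunction Φ 1 = ((2 ^ (1 / 2 : ℝ) * 5 ^ (-(5 / 4) : ℝ) * Real.pi : ℝ) : ℂ) *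
      (3 + 4 * c) ^ (1 / 4 : ℂ) := by
  have h5 : √5 ^ 2 = (5 : ℝ) := Real.sq_sqrt (by norm_num)
  rw [LFunction_one_of_values_mod_five Φ c h0 h1 h2 h3 h4, cpow_quarter_three_add_four hre hc,
    ← mul_assoc, ← Complex.ofReal_mul, ← pi_div_sin_pi_div_five]
  have hratio : (3 * √5 - 5) / 2 = (5 + √5) / 2 * (√5 - 2) := by linear_combination -h5 / 2
  rw [hratio]
  push_cast
  ring

lemma quarticMod5_LFunction_one :
    quarticMod5.LFunction 1 = ((2 ^ (1 / 2 : ℝ) * 5 ^ (-(5 / 4) : ℝ) * Real.pi : ℝ) : ℂ) *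
      (3 + 4 * Complex.I) ^ (1 / 4 : ℂ) :=
  LFunction_one_of_values_mod_five_eq_cpow _ Complex.I_re Complex.I_sq quarticMod5_zero
    quarticMod5_one quarticMod5_two quarticMod5_three quarticMod5_four

lemma quarticMod5_cube_LFunction_one :
    (quarticMod5 ^ 3).LFunction 1 = ((2 ^ (1 / 2 : ℝ) * 5 ^ (-(5 / 4) : ℝ) * Real.pi : ℝ) : ℂ) *
      (3 - 4 * Complex.I) ^ (1 / 4 : ℂ) := by
  have hI3 : Complex.I ^ 3 = -Complex.I := Complex.I_pow_three
  rw [show 3 - 4 * Complex.I = 3 + 4 * -Complex.I by ring]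
  refine LFunction_one_of_values_mod_five_eq_cpow _ (by simp) (by rw [neg_sq, Complex.I_sq])
    ?_ ?_ ?_ ?_ ?_ <;> rw [quarticMod5_cube_apply]
  · rw [quarticMod5_zero]; norm_num
  · rw [quarticMod5_one]; norm_num
  · rw [quarticMod5_two, hI3]
  · rw [quarticMod5_three]; linear_combination -hI3
  · rw [quarticMod5_four]; norm_num

lemma cpow_quarter_mul_cpow_quarter :
    (3 + 4 * Complex.I) ^ (1 / 4 : ℂ) * (3 - 4 * Complex.I) ^ (1 / 4 : ℂ) = (√5 : ℝ) := by
  have h5 : √5 ^ 2 = (5 : ℝ) := Real.sq_sqrt (by norm_num)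
  have ha : √((√5 + 2) / 2) ^ 2 = (√5 + 2) / 2 := Real.sq_sqrt (by positivity)
  have h5' : (√5 : ℂ) ^ 2 = 5 := by exact_mod_cast congrArg (fun r : ℝ => (r : ℂ)) h5
  have ha' : (√((√5 + 2) / 2) : ℂ) ^ 2 = (√5 + 2) / 2 := by
    exact_mod_cast congrArg (fun r : ℝ => (r : ℂ)) ha
  rw [show 3 - 4 * Complex.I = 3 + 4 * -Complex.I by ring,
    cpow_quarter_three_add_four Complex.I_re Complex.I_sq,
    cpow_quarter_three_add_four (c := -Complex.I) (by simp) (by rw [neg_sq, Complex.I_sq])]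
  linear_combination (1 - (√5 - 2) ^ 2 * Complex.I ^ 2) * ha' -
    (√5 + 2) / 2 * (√5 - 2) ^ 2 * Complex.I_sq + (√5 - 2) / 2 * h5'

/-! ### The quartic character modulo 10 -/

/-- The Dirichlet character modulo `10` with `3 ↦ i`, induced from the one modulo `5` with
`3 ↦ i`, the conjugate of `quarticMod5`. -/
noncomputable def quarticMod10 : DirichletCharacter ℂ 10 :=
  DirichletCharacter.changeLevel (by norm_num : 5 ∣ 10) (quarticMod5 ^ 3)

lemma quarticMod5_pow_five : quarticMod5 ^ 5 = quarticMod5 := by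
  rw [pow_succ, quarticMod5_pow_four, one_mul]

lemma quarticMod10_sq : quarticMod10 ^ 2 =
    DirichletCharacter.changeLevel (by norm_num : 5 ∣ 10) (quarticMod5 ^ 2) := by
  rw [quarticMod10, ← map_pow, ← pow_mul, show 3 * 2 = 5 + 1 by rfl, pow_succ,
    quarticMod5_pow_five, ← sq]

lemma quarticMod10_cube : quarticMod10 ^ 3 =
    DirichletCharacter.changeLevel (by norm_num : 5 ∣ 10) quarticMod5 := by
  rw [quarticMod10, ← map_pow, ← pow_mul, show 3 * 3 = 4 + 5 by rfl, pow_add,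
    quarticMod5_pow_four, quarticMod5_pow_five, one_mul]

lemma quarticMod10_pow_four : quarticMod10 ^ 4 = 1 := by
  rw [quarticMod10, ← map_pow, ← pow_mul, mul_comm, pow_mul, quarticMod5_pow_four, one_pow, map_one]

lemma quarticMod10_apply {n : ℕ} (hn : n.Coprime 10) : quarticMod10 n = quarticMod5 n ^ 3 := by
  have hn' : IsCoprime (n : ℤ) (10 : ℕ) := Nat.isCoprime_iff_coprime.mpr hn
  have h := DirichletCharacter.changeLevel_eq_cast_of_dvd' (quarticMod5 ^ 3)
    (by norm_num : 5 ∣ 10) hn'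
  rw [Int.cast_natCast, Int.cast_natCast] at h
  rw [← quarticMod5_cube_apply, ← h, quarticMod10]

lemma isFaithfulQuartic_quarticMod10 : IsFaithfulQuartic quarticMod10 where
  pow_four := quarticMod10_pow_four
  sq_ne_one h := by
    rw [quarticMod10_sq, ← map_one (DirichletCharacter.changeLevel (R := ℂ)
      (by norm_num : 5 ∣ 10))] at h
    exact quarticMod5_sq_ne_one (DirichletCharacter.changeLevel_injective _ h)
  apply_of_modEq p hp := by
    rw [(ZMod.natCast_eq_natCast_iff _ _ _).mpr hp, Nat.cast_one, map_one]
  apply_of_not_modEq p hp := by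
    by_cases hcop : p.Coprime 10
    · have hp5 : (p : ZMod 5) ≠ 1 := by
        intro h
        rw [← Nat.cast_one, ZMod.natCast_eq_natCast_iff] at h
        have h2 : p % 2 = 1 := Nat.odd_iff.mp
          (Nat.coprime_two_right.mp (Nat.Coprime.coprime_dvd_right (by norm_num) hcop))
        unfold Nat.ModEq at h hp
        omega
      rw [quarticMod10_apply hcop]
      rcases quarticMod5_apply_of_ne_one hp5 with h | h | h | h <;> rw [h]
      · exact .inl (by norm_num)
      · exact .inr (.inl (by norm_num))
      · exact .inr (.inr (.inr Complex.I_pow_three))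
      · exact .inr (.inr (.inl (by linear_combination -Complex.I_pow_three)))
    · exact .inl (MulChar.map_nonunit _ fun h => hcop ((ZMod.isUnit_iff_coprime p 10).mp h))

lemma quarticMod10_three : quarticMod10 3 = Complex.I := by
  have h := quarticMod10_apply (n := 3) (by norm_num)
  rw [Nat.cast_ofNat, Nat.cast_ofNat, quarticMod5_three] at h
  rw [h]
  linear_combination -Complex.I_pow_three

lemma primeFactors_ten : (10 : ℕ).primeFactors = {2, 5} := by
  rw [show 10 = 2 * 5 by rfl, Nat.primeFactors_mul two_ne_zero (by norm_num),
    Nat.Prime.primeFactors Nat.prime_two, Nat.Prime.primeFactors (by norm_num)]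
  rfl

/-- The factor of the prime `2` is the only one that is removed on passing from modulus `5` to
modulus `10`. -/
lemma LFunction_changeLevel_five_ten {ψ : DirichletCharacter ℂ 5} (hψ : ψ ≠ 1) (s : ℂ) :
    (DirichletCharacter.changeLevel (by norm_num : 5 ∣ 10) ψ).LFunction s =
      ψ.LFunction s * (1 - ψ 2 * 2 ^ (-s)) := by
  have h5 : ψ ((5 : ℕ) : ZMod 5) = 0 := ψ.map_zero' (by norm_num)
  rw [DirichletCharacter.LFunction_changeLevel _ _ (.inl hψ), primeFactors_ten,
    Finset.prod_pair (by norm_num), h5, zero_mul, sub_zero, mul_one, Nat.cast_ofNat, Nat.cast_ofNat]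

lemma two_rpow_mul_five_rpow :
    (2 : ℝ) ^ (-(1 / 2) : ℝ) * 5 ^ (-(3 / 4) : ℝ) =
      2 ^ (1 / 2 : ℝ) * 5 ^ (-(5 / 4) : ℝ) * (√5 / 2) := by
  rw [Real.sqrt_eq_rpow, show (-(3 / 4) : ℝ) = -(5 / 4) + 1 / 2 by norm_num,
    Real.rpow_add (by norm_num), show (-(1 / 2) : ℝ) = 1 / 2 - 1 by norm_num,
    Real.rpow_sub (by norm_num), Real.rpow_one]
  ring

/-- The effect on `L(χ, 1)` of the Euler factor at `2`, which is `1 + c / 2`. -/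
lemma cpow_quarter_mul {c : ℂ} (hre : c.re = 0) (hc : c ^ 2 = -1) :
    (3 - 4 * c) ^ (1 / 4 : ℂ) * (1 + c / 2) = √5 / 2 * (3 + 4 * c) ^ (1 / 4 : ℂ) := by
  have h5' : (√5 : ℂ) ^ 2 = 5 := by
    exact_mod_cast congrArg (fun r : ℝ => (r : ℂ)) (Real.sq_sqrt (by norm_num : (0 : ℝ) ≤ 5))
  rw [show 3 - 4 * c = 3 + 4 * -c by ring, cpow_quarter_three_add_four hre hc,
    cpow_quarter_three_add_four (c := -c) (by simp [hre]) (by rw [neg_sq, hc])]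
  linear_combination (√((√5 + 2) / 2) : ℂ) * (-(√5 - 2) / 2 * hc - c / 2 * h5')

lemma quarticMod10_LFunction_one :
    quarticMod10.LFunction 1 =
      ((2 ^ (-(1 / 2) : ℝ) * 5 ^ (-(3 / 4) : ℝ) * Real.pi : ℝ) : ℂ) *
        (3 + 4 * Complex.I) ^ (1 / 4 : ℂ) := by
  rw [quarticMod10, LFunction_changeLevel_five_ten isFaithfulQuartic_quarticMod5.cube_ne_one,
    quarticMod5_cube_LFunction_one, quarticMod5_cube_apply, quarticMod5_two, Complex.I_pow_three,
    Complex.cpow_neg_one, two_rpow_mul_five_rpow]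
  have h := cpow_quarter_mul Complex.I_re Complex.I_sq
  push_cast
  linear_combination ((2 ^ (1 / 2 : ℝ) : ℝ) : ℂ) * ((5 ^ (-(5 / 4) : ℝ) : ℝ) : ℂ) * Real.pi * h

lemma quarticMod10_cube_LFunction_one :
    (quarticMod10 ^ 3).LFunction 1 =
      ((2 ^ (-(1 / 2) : ℝ) * 5 ^ (-(3 / 4) : ℝ) * Real.pi : ℝ) : ℂ) *
        (3 - 4 * Complex.I) ^ (1 / 4 : ℂ) := by
  rw [quarticMod10_cube, LFunction_changeLevel_five_ten isFaithfulQuartic_quarticMod5.ne_one,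
    quarticMod5_LFunction_one, quarticMod5_two, Complex.cpow_neg_one, two_rpow_mul_five_rpow]
  have h := cpow_quarter_mul (c := -Complex.I) (by simp) (by rw [neg_sq, Complex.I_sq])
  rw [mul_neg, sub_neg_eq_add, ← sub_eq_add_neg] at h
  push_cast
  linear_combination ((2 ^ (1 / 2 : ℝ) : ℝ) : ℂ) * ((5 ^ (-(5 / 4) : ℝ) : ℝ) : ℂ) * Real.pi * h

lemma quarticMod10_sq_LFunction_one :
    (quarticMod10 ^ 2).LFunction 1 = ((Real.log (2 + √5) / √5 : ℝ) : ℂ) := by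
  rw [quarticMod10_sq, LFunction_changeLevel_five_ten quarticMod5_sq_ne_one,
    quarticMod5_sq_LFunction_one, quarticMod5_sq_apply, quarticMod5_two, Complex.I_sq,
    Complex.cpow_neg_one]
  have h50 : (√5 : ℂ) ≠ 0 := by exact_mod_cast (by positivity : √5 ≠ 0)
  push_cast
  field_simp
  norm_num

lemma quarticMod10_sq_LFunction_two :
    (quarticMod10 ^ 2).LFunction 2 = ((Real.pi ^ 2 * √5 / 25 : ℝ) : ℂ) := by
  rw [quarticMod10_sq, LFunction_changeLevel_five_ten quarticMod5_sq_ne_one,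
    quarticMod5_sq_LFunction_two, quarticMod5_sq_apply, quarticMod5_two, Complex.I_sq,
    Complex.cpow_neg, Complex.cpow_ofNat]
  push_cast
  ring

/-! ### The residues -/

lemma LFunction_one_two (ℓ : ℕ) [NeZero ℓ] : (1 : DirichletCharacter ℂ ℓ).LFunction 2 =
    (∏ p ∈ ℓ.primeFactors, (1 - ((p : ℂ) ^ 2)⁻¹)) * (Real.pi ^ 2 / 6) := by
  have h := DirichletCharacter.LFunctionTrivChar_eq_mul_riemannZeta (N := ℓ) (s := 2) (by norm_num)
  rw [riemannZeta_two] at h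
  simp only [Complex.cpow_neg, Complex.cpow_ofNat] at h
  exact h

lemma sq_two_rpow_mul_five_rpow :
    ((2 : ℝ) ^ (1 / 2 : ℝ) * 5 ^ (-(5 / 4) : ℝ)) ^ 2 = 2 * √5 / 125 := by
  rw [mul_pow, sq_two_rpow_half, sq_five_rpow]
  ring

/-- The product of the values at `1` of the two odd quartic characters modulo `5`. -/
lemma quarticMod5_LFunction_one_mul :
    quarticMod5.LFunction 1 * (quarticMod5 ^ 3).LFunction 1 = 2 * Real.pi ^ 2 / 25 := by
  have h5' : (√5 : ℂ) ^ 2 = 5 := by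
    exact_mod_cast congrArg (fun r : ℝ => (r : ℂ)) (Real.sq_sqrt (by norm_num : (0 : ℝ) ≤ 5))
  have h := congrArg (fun r : ℝ => (r : ℂ)) sq_two_rpow_mul_five_rpow
  rw [quarticMod5_LFunction_one, quarticMod5_cube_LFunction_one]
  have hc := cpow_quarter_mul_cpow_quarter
  push_cast at h ⊢
  generalize ((2 ^ (1 / 2 : ℝ) : ℝ) : ℂ) = a at *
  generalize ((5 ^ (-(5 / 4) : ℝ) : ℝ) : ℂ) = b at *
  linear_combination a ^ 2 * b ^ 2 * Real.pi ^ 2 * hc + Real.pi ^ 2 * √5 * h +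
    2 * Real.pi ^ 2 / 125 * h5'

/-- The product of the values at `1` of the two odd quartic characters modulo `10`. -/
lemma quarticMod10_LFunction_one_mul :
    quarticMod10.LFunction 1 * (quarticMod10 ^ 3).LFunction 1 = Real.pi ^ 2 / 10 := by
  rw [quarticMod10, LFunction_changeLevel_five_ten isFaithfulQuartic_quarticMod5.cube_ne_one,
    ← quarticMod10, quarticMod10_cube,
    LFunction_changeLevel_five_ten isFaithfulQuartic_quarticMod5.ne_one, quarticMod5_cube_apply,
    quarticMod5_two, Complex.I_pow_three, Complex.cpow_neg_one]
  linear_combination (5 / 4) * quarticMod5_LFunction_one_mul -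
    quarticMod5.LFunction 1 * (quarticMod5 ^ 3).LFunction 1 / 4 * Complex.I_sq

lemma hasResidueAtOne_five : HasResidueAtOne 1 5 (rhoValue 5 : ℂ) := by
  have h := isFaithfulQuartic_quarticMod5.hasResidueAtOne (by decide)
  convert h using 1
  have h5 : (√5 : ℂ) ^ 2 = 5 := by
    exact_mod_cast congrArg (fun r : ℝ => (r : ℂ)) (Real.sq_sqrt (by norm_num : (0 : ℝ) ≤ 5))
  have h50 : (√5 : ℂ) ≠ 0 := by exact_mod_cast (by positivity : √5 ≠ 0)
  have hπ : (Real.pi : ℂ) ≠ 0 := by exact_mod_cast Real.pi_ne_zero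
  rw [rhoValue, Complex.ofReal_mul, ofReal_tprod_primesMod, LFunction_one_two,
    Nat.Prime.primeFactors (by norm_num), Finset.prod_singleton, Finset.prod_singleton,
    mul_right_comm (_ * _), mul_assoc (1 - _), quarticMod5_LFunction_one_mul,
    quarticMod5_sq_LFunction_one, quarticMod5_sq_LFunction_two]
  congr 1
  push_cast
  field_simp
  rw [h5]
  norm_num
  ring

lemma hasResidueAtOne_ten : HasResidueAtOne 1 10 (rhoValue 10 : ℂ) := by
  have h := isFaithfulQuartic_quarticMod10.hasResidueAtOne (by decide)
  convert h using 1
  have h5 : (√5 : ℂ) ^ 2 = 5 := by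
    exact_mod_cast congrArg (fun r : ℝ => (r : ℂ)) (Real.sq_sqrt (by norm_num : (0 : ℝ) ≤ 5))
  have h50 : (√5 : ℂ) ≠ 0 := by exact_mod_cast (by positivity : √5 ≠ 0)
  have hπ : (Real.pi : ℂ) ≠ 0 := by exact_mod_cast Real.pi_ne_zero
  rw [rhoValue, Complex.ofReal_mul, ofReal_tprod_primesMod, LFunction_one_two,
    primeFactors_ten, Finset.prod_pair (by norm_num), Finset.prod_pair (by norm_num),
    mul_right_comm (_ * _), mul_assoc (_ * (1 - _)), quarticMod10_LFunction_one_mul,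
    quarticMod10_sq_LFunction_one, quarticMod10_sq_LFunction_two]
  congr 1
  push_cast
  field_simp
  rw [h5]
  norm_num
  ring

theorem mainTheorem1 :
    -- the residue formula, with convergence of both products
    (∀ ℓ : ℕ, ℓ = 5 ∨ ℓ = 10 →
      (∀ s : ℂ, 1 < s.re → Multipliable (fun p : PrimesMod 1 ℓ => progressionFactor ℓ s p)) ∧
      Multipliable (fun p : PrimesMod 1 ℓ => (1 - 1 / (p : ℝ) ^ 2) ^ (-2 : ℤ)) ∧
      IsRho 1 ℓ (rhoValue ℓ : ℂ) ∧
      HasResidueAtOne 1 ℓ (rhoValue ℓ : ℂ)) ∧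
    -- modulo 5: the quartic character is the one with value `i` at `2`
    (∃ χ : DirichletCharacter ℂ 5, χ 2 = Complex.I ∧
      (∀ s : ℂ, 1 < s.re → HasProd
        (fun p : PrimesMod 1 5 =>
          ((1 + 1 / ((p : ℕ) : ℂ) ^ s) / (1 - 1 / ((p : ℕ) : ℂ) ^ s)) ^ 2)
        (quarticQuotient χ s)) ∧
      χ.LFunction 1 =
        ((2 ^ (1 / 2 : ℝ) * 5 ^ (-(5 / 4) : ℝ) * Real.pi : ℝ) : ℂ) *
          (3 + 4 * Complex.I) ^ (1 / 4 : ℂ) ∧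
      (χ ^ 2).LFunction 1 = ((2 * Real.log (2 + √5) / (3 * √5) : ℝ) : ℂ) ∧
      (χ ^ 3).LFunction 1 =
        ((2 ^ (1 / 2 : ℝ) * 5 ^ (-(5 / 4) : ℝ) * Real.pi : ℝ) : ℂ) *
          (3 - 4 * Complex.I) ^ (1 / 4 : ℂ) ∧
      (χ ^ 2).LFunction 2 = ((4 * Real.pi ^ 2 * √5 / 125 : ℝ) : ℂ)) ∧
    -- modulo 10: the quartic character is the one with value `i` at `3`
    (∃ χ : DirichletCharacter ℂ 10, χ 3 = Complex.I ∧
      (∀ s : ℂ, 1 < s.re → HasProd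
        (fun p : PrimesMod 1 10 =>
          ((1 + 1 / ((p : ℕ) : ℂ) ^ s) / (1 - 1 / ((p : ℕ) : ℂ) ^ s)) ^ 2)
        (quarticQuotient χ s)) ∧
      χ.LFunction 1 =
        ((2 ^ (-(1 / 2) : ℝ) * 5 ^ (-(3 / 4) : ℝ) * Real.pi : ℝ) : ℂ) *
          (3 + 4 * Complex.I) ^ (1 / 4 : ℂ) ∧
      (χ ^ 2).LFunction 1 = ((Real.log (2 + √5) / √5 : ℝ) : ℂ) ∧
      (χ ^ 3).LFunction 1 =
        ((2 ^ (-(1 / 2) : ℝ) * 5 ^ (-(3 / 4) : ℝ) * Real.pi : ℝ) : ℂ) *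
          (3 - 4 * Complex.I) ^ (1 / 4 : ℂ) ∧
      (χ ^ 2).LFunction 2 = ((Real.pi ^ 2 * √5 / 25 : ℝ) : ℂ)) := by
  refine ⟨?_, ⟨quarticMod5, quarticMod5_two,
      fun s hs => isFaithfulQuartic_quarticMod5.hasProd_quarticQuotient hs,
      quarticMod5_LFunction_one, quarticMod5_sq_LFunction_one, quarticMod5_cube_LFunction_one,
      quarticMod5_sq_LFunction_two⟩,
    ⟨quarticMod10, quarticMod10_three,
      fun s hs => isFaithfulQuartic_quarticMod10.hasProd_quarticQuotient hs,
      quarticMod10_LFunction_one, quarticMod10_sq_LFunction_one, quarticMod10_cube_LFunction_one,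
      quarticMod10_sq_LFunction_two⟩⟩
  rintro ℓ (rfl | rfl)
  · exact ⟨fun s hs =>
        (isFaithfulQuartic_quarticMod5.hasProd_progressionFactor (by decide) hs).multipliable,
      (hasProd_real_partialZeta_two_sq 1 5).multipliable, hasResidueAtOne_five.isRho,
      hasResidueAtOne_five⟩
  · exact ⟨fun s hs =>
        (isFaithfulQuartic_quarticMod10.hasProd_progressionFactor (by decide) hs).multipliable,
      (hasProd_real_partialZeta_two_sq 1 10).multipliable, hasResidueAtOne_ten.isRho,
      hasResidueAtOne_ten⟩
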